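/- Let $a<b$, let $L^2=L^2(a,b)$ be the real Hilbert space with norm $\|\cdot\|$ and closed unit ball $B$, and let $Kf(x)=\int_a^b K(x,y)f(y)\,dy$ be an integral operator on $L^2$ with square-integrable kernel (for instance a continuous or piecewise continuous one), with adjoint $K^*$. Let $\lambda_1\ge\lambda_2\ge\dots\ge 0$ be the eigenvalues of $K^*K$, counted with multiplicity. Put $A^0=\{u\in B: u\perp\ker K^*\}$, $A^0_*=\{u\in B: u\perp\ker K\}$, $A^1=A=K(B)$, $A^1_*=A_*=K^*(B)$, and $A^r=K(A^{r-1}_*)$, $A^r_*=K^*(A^{r-1})$ for integers $r\ge2$. Let $\partial$ denote the weak derivative on $H^1(a,b)$. Assume that for every integer $r\ge 0$ the operator $K$ maps $A^r_*$ into $H^1(a,b)$, $K^*$ maps $A^r$ into $H^1(a,b)$, and $$\partial Kf=f\quad(f\in A^r_*),\qquad \partial K^*g=-g\quad(g\in A^r).$$ For a finite-dimensional subspace $\mathbb X\subset L^2$ with orthogonal projector $X$ and a set $S\subset L^2$, put $E(S,\mathbb X)=\sup_{u\in S}\|u-Xu\|$ and $d_n(S)=\inf_{\dim\mathbb X=n}E(S,\mathbb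 X)$; call $\mathbb X$ optimal for the $n$-width of $S$ if $\dim\mathbb X\le n$ and $E(S,\mathbb X)=d_n(S)$. Let $n\ge0$ be an integer, and let $\mathbb X_0,\mathbb Y_0$ be finite-dimensional subspaces of $L^2$ with $\mathbb X_0\perp\ker K^*$ and $\mathbb Y_0\perp\ker K$, such that $\mathbb X_0$ is optimal for the $n$-width of $A$ and $\mathbb Y_0$ is optimal for the $n$-width of $A_*$. For $p\ge1$ put $\mathbb X_p=K(\mathbb Y_{p-1})$ and $\mathbb Y_p=K^*(\mathbb X_{p-1})$; let $X_p,Y_p$ be the $L^2$-orthogonal projectors onto $\mathbb X_p,\mathbb Y_p$ ($p\ge0$), and for $p\ge1$ define the Ritz projectors $$R_{\mathbb X_p}=K\,Y_{p-1}\,\partial\ \text{ on } K(L^2),\qquad R_{\mathbb Y_p}=-K^*X_{p-1}\,\partial\ \text{ on } K^*(L^2).$$ Then for all integers $r\ge1$ and $p\ge\max\{1,r-1\}$, all the functions below to which $\partial$ is applied lie in $H^1(a,b)$, and $$\|u-R_{\mathbb X_p}u\|\le\lambda_{n+1}^{r/2},\qquad \|\partial u-\partial R_{\mathbb X_p}u\|\le\lambda_{n+1}^{(r-1)/2}\qquad\text{for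 all }u\in A^r,$$ $$\|u-R_{\mathbb Y_p}u\|\le\lambda_{n+1}^{r/2},\qquad \|\partial u-\partial R_{\mathbb Y_p}u\|\le\lambda_{n+1}^{(r-1)/2}\qquad\text{for all }u\in A^r_*$$ (with $0^0=1$ if $\lambda_{n+1}=0$ and $r=1$). -/

import Mathlib

open MeasureTheory
open scoped ContDiff

noncomputable section

namespace RitzWidth

/-! ### The space `L²(a, b)`, weak derivatives and integral operators -/

/-- Lebesgue measure on the interval `(a, b)`. -/
abbrev vol (a b : ℝ) : Measure ℝ := volume.restrict (Set.Ioo a b)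

/-- The real Hilbert space `L²(a, b)`. -/
abbrev L2 (a b : ℝ) : Type := Lp ℝ 2 (vol a b)

/-- `v` is the weak (distributional) derivative of `u` on `(a, b)`. -/
def HasWeakDeriv {a b : ℝ} (u v : L2 a b) : Prop :=
  ∀ φ : ℝ → ℝ, ContDiff ℝ ∞ φ → HasCompactSupport φ → tsupport φ ⊆ Set.Ioo a b →
    ∫ x in Set.Ioo a b, u x * deriv φ x = - ∫ x in Set.Ioo a b, v x * φ x

/-- Membership in `H¹(a, b)`: a weak derivative exists in `L²(a, b)`. -/
def MemH1 {a b : ℝ} (u : L2 a b) : Prop := ∃ v : L2 a b, HasWeakDeriv u v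

open Classical in
/-- The derivative operator `∂` on `H¹(a, b)` (with value `0` outside `H¹(a, b)`). -/
def weakDeriv {a b : ℝ} (u : L2 a b) : L2 a b :=
  if h : MemH1 u then h.choose else 0

section IntegralOperator

/-- Pointwise Cauchy-Schwarz inequality for the integral of a kernel against a function. -/
theorem kernel_pointwise_bound {μ : Measure ℝ} {k : ℝ → ℝ → ℝ} {f : ℝ → ℝ} (hf : MemLp f 2 μ) {x : ℝ}
    (hx : AEStronglyMeasurable (k x) μ) :
    (∫⁻ y, ‖k x y * f y‖ₑ ∂μ) ^ (2 : ℝ)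
      ≤ (∫⁻ y, ‖k x y‖ₑ ^ (2 : ℝ) ∂μ) * ∫⁻ y, ‖f y‖ₑ ^ (2 : ℝ) ∂μ := by
  have h := ENNReal.lintegral_mul_le_Lp_mul_Lq μ Real.HolderConjugate.two_two
    hx.enorm hf.1.enorm
  have h2 := ENNReal.rpow_le_rpow h (by norm_num : (0 : ℝ) ≤ 2)
  rw [ENNReal.mul_rpow_of_nonneg _ _ (by norm_num), ← ENNReal.rpow_mul, ← ENNReal.rpow_mul] at h2
  norm_num at h2
  simpa [enorm_mul] using h2

variable {μ : Measure ℝ} [SFinite μ]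

theorem kernel_ae_section {k : ℝ → ℝ → ℝ} (hk : MemLp (Function.uncurry k) 2 (μ.prod μ)) :
    ∀ᵐ x ∂μ, MemLp (k x) 2 μ := by
  have h1 : ∀ᵐ x ∂μ, AEStronglyMeasurable (k x) μ := hk.1.prodMk_left
  have hfin : ∫⁻ z, ‖Function.uncurry k z‖ₑ ^ (2 : ℝ) ∂(μ.prod μ) < ⊤ := by
    have := lintegral_rpow_enorm_lt_top_of_eLpNorm_lt_top (by norm_num) (by norm_num) hk.2
    simpa using this
  rw [lintegral_prod _ (hk.1.enorm.pow_const _)] at hfin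
  have h2 := ae_lt_top' (hk.1.enorm.pow_const (2 : ℝ)).lintegral_prod_right' hfin.ne
  filter_upwards [h1, h2] with x hx1 hx2
  refine ⟨hx1, ?_⟩
  refine (eLpNorm_lt_top_iff_lintegral_rpow_enorm_lt_top (by norm_num) (by norm_num)).2 ?_
  simpa [Function.uncurry] using hx2

theorem kernel_eLpNorm_le {k : ℝ → ℝ → ℝ} (hk : MemLp (Function.uncurry k) 2 (μ.prod μ))
    {f : ℝ → ℝ} (hf : MemLp f 2 μ) :
    eLpNorm (fun x => ∫ y, k x y * f y ∂μ) 2 μ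
      ≤ eLpNorm (Function.uncurry k) 2 (μ.prod μ) * eLpNorm f 2 μ := by
  rw [eLpNorm_eq_lintegral_rpow_enorm_toReal (by norm_num) (by norm_num),
    eLpNorm_eq_lintegral_rpow_enorm_toReal (by norm_num) (by norm_num),
    eLpNorm_eq_lintegral_rpow_enorm_toReal (by norm_num) (by norm_num),
    ← ENNReal.mul_rpow_of_nonneg _ _ (by positivity)]
  refine ENNReal.rpow_le_rpow ?_ (by positivity)
  simp only [ENNReal.toReal_ofNat]
  rw [lintegral_prod _ (hk.1.enorm.pow_const _),
    ← lintegral_mul_const'' _ (hk.1.enorm.pow_const (2 : ℝ)).lintegral_prod_right']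
  refine lintegral_mono_ae ?_
  filter_upwards [kernel_ae_section hk] with x hx
  refine le_trans ?_ (kernel_pointwise_bound hf hx.1)
  exact ENNReal.rpow_le_rpow (enorm_integral_le_lintegral_enorm _) (by norm_num)

theorem kernel_memLp {k : ℝ → ℝ → ℝ} (hk : MemLp (Function.uncurry k) 2 (μ.prod μ))
    {f : ℝ → ℝ} (hf : MemLp f 2 μ) : MemLp (fun x => ∫ y, k x y * f y ∂μ) 2 μ := by
  refine ⟨?_, (kernel_eLpNorm_le hk hf).trans_lt (ENNReal.mul_lt_top hk.2 hf.2)⟩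
  exact AEStronglyMeasurable.integral_prod_right'
    (f := fun z : ℝ × ℝ => k z.1 z.2 * f z.2) (hk.1.mul hf.1.comp_snd)

/-- The integral operator `K f (x) = ∫ k(x, y) f(y) dy` on `L²(μ)` with square-integrable
kernel `k`. -/
def integralOp (k : ℝ → ℝ → ℝ) (hk : MemLp (Function.uncurry k) 2 (μ.prod μ)) :
    Lp ℝ 2 μ →L[ℝ] Lp ℝ 2 μ :=
  LinearMap.mkContinuous
    { toFun := fun f => (kernel_memLp hk (Lp.memLp f)).toLp (fun x => ∫ y, k x y * f y ∂μ)
      map_add' := by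
        intro f g
        rw [← MemLp.toLp_add, MemLp.toLp_eq_toLp_iff]
        filter_upwards [kernel_ae_section hk] with x hx
        have hf : Integrable (fun y => k x y * f y) μ := hx.integrable_mul (Lp.memLp f)
        have hg : Integrable (fun y => k x y * g y) μ := hx.integrable_mul (Lp.memLp g)
        simp only [Pi.add_apply]
        rw [← integral_add hf hg]
        refine integral_congr_ae ?_
        filter_upwards [Lp.coeFn_add f g] with y hy
        rw [hy, Pi.add_apply, mul_add]
      map_smul' := by
        intro c f
        rw [RingHom.id_apply, ← MemLp.toLp_const_smul, MemLp.toLp_eq_toLp_iff]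
        refine Filter.Eventually.of_forall fun x => ?_
        simp only [Pi.smul_apply, smul_eq_mul]
        rw [← integral_const_mul]
        refine integral_congr_ae ?_
        filter_upwards [Lp.coeFn_smul c f] with y hy
        rw [hy, Pi.smul_apply, smul_eq_mul]
        ring }
    (eLpNorm (Function.uncurry k) 2 (μ.prod μ)).toReal
    (by
      intro f
      simp only [LinearMap.coe_mk, AddHom.coe_mk, Lp.norm_toLp]
      rw [Lp.norm_def, ← ENNReal.toReal_mul]
      exact ENNReal.toReal_mono (ENNReal.mul_lt_top hk.2 (Lp.memLp f).2).ne
        (kernel_eLpNorm_le hk (Lp.memLp f)))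

theorem integralOp_coeFn (k : ℝ → ℝ → ℝ) (hk : MemLp (Function.uncurry k) 2 (μ.prod μ))
    (f : Lp ℝ 2 μ) : integralOp k hk f =ᵐ[μ] fun x => ∫ y, k x y * f y ∂μ :=
  (kernel_memLp hk (Lp.memLp f)).coeFn_toLp

end IntegralOperator

/-! ### Widths, eigenvalues, function classes and subspaces in a real Hilbert space -/

section Hilbert

variable {H : Type*} [NormedAddCommGroup H] [InnerProductSpace ℝ H]

/-- `E(A, X) = sup_{u ∈ A} ‖u - P_X u‖`, where `P_X` is the orthogonal projector onto `X`. -/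
def approxError (A : Set H) (X : Submodule ℝ H) [FiniteDimensional ℝ X] : ENNReal :=
  ⨆ u ∈ A, ‖u - X.starProjection u‖ₑ

/-- The Kolmogorov `n`-width `d_n(A)`. -/
def nWidth (n : ℕ) (A : Set H) : ENNReal :=
  ⨅ (X : Submodule ℝ H) (_ : FiniteDimensional ℝ X) (_ : Module.finrank ℝ X = n),
    approxError A X

/-- `X` is an optimal subspace for `d_n(A)`. -/
def IsOptimal (n : ℕ) (A : Set H) (X : Submodule ℝ H) [FiniteDimensional ℝ X] : Prop :=
  Module.finrank ℝ X ≤ n ∧ nWidth n A = approxError A X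

/-- For `l ≥ 1`, the `l`-th largest eigenvalue, counted with multiplicity, of a compact positive
semi-definite operator `T`: the largest `m` such that there are `l` orthonormal eigenvectors
of `T` whose eigenvalues are all at least `m`. -/
def nthEigenvalue (T : H →L[ℝ] H) (l : ℕ) : ℝ :=
  sSup {m : ℝ | ∃ v : Fin l → H, Orthonormal ℝ v ∧ ∀ i, ∃ ν : ℝ, m ≤ ν ∧ T (v i) = ν • v i}

/-- The function classes. With `S = K`, `T = K*` this is `A^r`; with `S = K*`, `T = K` it
is `A^r_*`. -/
def funClass (S T : H →L[ℝ] H) : ℕ → Set H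
  | 0 => {u | ‖u‖ ≤ 1 ∧ ∀ w, T w = 0 → inner ℝ w u = 0}
  | 1 => S '' Metric.closedBall 0 1
  | r + 2 => S '' funClass T S (r + 1)

/-- The approximation spaces. With `S = K`, `T = K*`, `V = X₀`, `W = Y₀` this is `X_p`; with
`S = K*`, `T = K`, `V = Y₀`, `W = X₀` it is `Y_p`. -/
def approxSpace (S T : H →L[ℝ] H) (V W : Submodule ℝ H) : ℕ → Submodule ℝ H
  | 0 => V
  | p + 1 => (approxSpace T S W V p).map (S : H →ₗ[ℝ] H)

theorem finiteDimensional_approxSpace (p : ℕ) : ∀ (S T : H →L[ℝ] H) (V W : Submodule ℝ H)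
    [FiniteDimensional ℝ V] [FiniteDimensional ℝ W],
    FiniteDimensional ℝ (approxSpace S T V W p) := by
  induction p with
  | zero => intro S T V W _ _; rw [approxSpace]; infer_instance
  | succ p ih =>
    intro S T V W _ _
    have := ih T S W V
    rw [approxSpace]
    infer_instance

instance (S T : H →L[ℝ] H) (V W : Submodule ℝ H) [FiniteDimensional ℝ V]
    [FiniteDimensional ℝ W] (p : ℕ) : FiniteDimensional ℝ (approxSpace S T V W p) :=
  finiteDimensional_approxSpace p S T V W

end Hilbert

/-! ### The objects attached to an operator `K` on `L²(a, b)` -/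

section Operator

variable {a b : ℝ} (K : L2 a b →L[ℝ] L2 a b)

/-- The class `A^r`. -/
def classA (r : ℕ) : Set (L2 a b) := funClass K (ContinuousLinearMap.adjoint K) r

/-- The class `A^r_*`. -/
def classAstar (r : ℕ) : Set (L2 a b) := funClass (ContinuousLinearMap.adjoint K) K r

/-- The number `λ_l`, the `l`-th largest eigenvalue of `K* K`, for `l ≥ 1`. -/
def eigval (l : ℕ) : ℝ := nthEigenvalue ((ContinuousLinearMap.adjoint K).comp K) l

/-- The standing assumption that `∂ K = I` on every `A^r_*` and `∂ K* = -I` on every `A^r`,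
for `r ≥ 0`. -/
def DerivInverse : Prop :=
  (∀ r : ℕ, ∀ f ∈ classAstar K r, HasWeakDeriv (K f) f) ∧
  (∀ r : ℕ, ∀ g ∈ classA K r, HasWeakDeriv (ContinuousLinearMap.adjoint K g) (-g))

variable (X₀ Y₀ : Submodule ℝ (L2 a b)) [FiniteDimensional ℝ X₀] [FiniteDimensional ℝ Y₀]

/-- The space `X_p`. -/
abbrev spaceX (p : ℕ) : Submodule ℝ (L2 a b) :=
  approxSpace K (ContinuousLinearMap.adjoint K) X₀ Y₀ p

/-- The space `Y_p`. -/
abbrev spaceY (p : ℕ) : Submodule ℝ (L2 a b) :=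
  approxSpace (ContinuousLinearMap.adjoint K) K Y₀ X₀ p

/-- The Ritz projector `R_{X_p} = K Y_{p-1} ∂`, for `p ≥ 1`, to be applied to functions
in `K(L²(a, b))`. -/
def ritzX (p : ℕ) (u : L2 a b) : L2 a b :=
  K ((spaceY K X₀ Y₀ (p - 1)).starProjection (weakDeriv u))

/-- The Ritz projector `R_{Y_p} = -K* X_{p-1} ∂`, for `p ≥ 1`, to be applied to functions
in `K*(L²(a, b))`. -/
def ritzY (p : ℕ) (u : L2 a b) : L2 a b :=
  -(ContinuousLinearMap.adjoint K ((spaceX K X₀ Y₀ (p - 1)).starProjection (weakDeriv u)))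

end Operator

end RitzWidth

end

/-! Write `s` for the square root of `λ_{n+1}`. Optimality of `X₀` and `Y₀` enters only through `‖(I
- X₀) K‖ ≤ s` and `‖(I - Y₀) K*‖ ≤ s`. These hold because the span `V` of the top `n` eigenvectors
of `K* K` satisfies `‖K (I - P_V)‖ ≤ s`, so that `K(V)` is a good competitor for `A` and, by
duality, `V` itself is one for `A_*` (`IsOptimal.norm_sub_starProjection_le_sqrt_nthEigenvalue`).

Two facts propagate these bounds. Taking adjoints, `‖(I - P) S‖ ≤ s` is equivalent to `‖S* (I - P)‖
≤ s`; since `K Y_p f` lies in `X_{p+1}`, all the spaces inherit the bound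
(`norm_sub_starProjection_approxSpace_le`). As `I - P` is idempotent, `‖K (I - Y_p) f‖ ≤ s ‖(I -
Y_p) f‖`, so each application of `K` or `K*` gains one factor `s`
(`norm_sub_starProjection_le_pow_of_mem_funClass`).

For `u = K f` with `f` in `A^{r-1}_*`, one has `∂u = f`, so the Ritz error is `K (I - Y_{p-1}) f`
and its derivative is `(I - Y_{p-1}) f`; they are bounded by `s^r` and `s^{r-1}`. The other family
is the same with `K` and `K*` exchanged and two signs cancelling (`ritz_estimates`). -/

namespace RitzWidth

/-! ### Orthogonal projectors and duality -/

section Projection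

variable {H : Type*} [NormedAddCommGroup H] [InnerProductSpace ℝ H]

theorem norm_sub_starProjection_le_of_mem (U : Submodule ℝ H) [U.HasOrthogonalProjection] {v : H}
    (hv : v ∈ U) (y : H) : ‖y - U.starProjection y‖ ≤ ‖y - v‖ := by
  rw [Submodule.starProjection_minimal]
  exact ciInf_le (f := fun x : U => ‖y - x‖) ⟨0, by rintro _ ⟨x, rfl⟩; positivity⟩ ⟨v, hv⟩

theorem norm_sub_starProjection_le (U : Submodule ℝ H) [U.HasOrthogonalProjection] (y : H) :
    ‖y - U.starProjection y‖ ≤ ‖y‖ := by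
  simpa using norm_sub_starProjection_le_of_mem U U.zero_mem y

theorem starProjection_sub_self (U : Submodule ℝ H) [U.HasOrthogonalProjection] (y : H) :
    U.starProjection (y - U.starProjection y) = 0 := by
  rw [Submodule.starProjection_apply_eq_zero_iff]
  exact U.sub_starProjection_mem_orthogonal y

theorem inner_sub_starProjection (U : Submodule ℝ H) [U.HasOrthogonalProjection] (x y : H) :
    inner ℝ (x - U.starProjection x) y = inner ℝ x (y - U.starProjection y) := by
  rw [inner_sub_left, inner_sub_right, U.inner_starProjection_left_eq_right]

variable [CompleteSpace H]

/-- The bound `‖(I - P) S‖ ≤ s` passes to the adjoint `S* (I - P)`. -/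
theorem norm_adjoint_sub_starProjection_le {S T : H →L[ℝ] H}
    (hST : S = ContinuousLinearMap.adjoint T) (U : Submodule ℝ H) [U.HasOrthogonalProjection]
    {s : ℝ} (h : ∀ f, ‖S f - U.starProjection (S f)‖ ≤ s * ‖f‖) (g : H) :
    ‖T (g - U.starProjection g)‖ ≤ s * ‖g‖ := by
  set w := T (g - U.starProjection g) with hw
  have h1 : ‖w‖ * ‖w‖ ≤ s * ‖w‖ * ‖g‖ := by
    calc ‖w‖ * ‖w‖ = inner ℝ w w := (real_inner_self_eq_norm_mul_norm w).symm
      _ = inner ℝ (S w) (g - U.starProjection g) := by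
          rw [hST, ContinuousLinearMap.adjoint_inner_left]
      _ = inner ℝ (S w - U.starProjection (S w)) g := (inner_sub_starProjection U _ _).symm
      _ ≤ ‖S w - U.starProjection (S w)‖ * ‖g‖ := real_inner_le_norm _ _
      _ ≤ s * ‖w‖ * ‖g‖ := by gcongr; exact h w
  -- `s` is not assumed nonnegative, so for `w = 0` the claim `0 ≤ s * ‖g‖` has to be read off from
  -- `h g`.
  rcases (norm_nonneg w).eq_or_lt with h0 | h0
  · have := (norm_nonneg _).trans (h g)
    rwa [← h0]
  · nlinarith

/-- The converse passage, from `‖T (I - P)‖ ≤ s` to `(I - P) T*`. -/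
theorem norm_sub_starProjection_adjoint_le {S T : H →L[ℝ] H}
    (hST : S = ContinuousLinearMap.adjoint T) (U : Submodule ℝ H) [U.HasOrthogonalProjection]
    {s : ℝ} (h : ∀ g, ‖T (g - U.starProjection g)‖ ≤ s * ‖g‖) (f : H) :
    ‖S f - U.starProjection (S f)‖ ≤ s * ‖f‖ := by
  set w := S f - U.starProjection (S f) with hw
  have h1 : ‖w‖ * ‖w‖ ≤ s * ‖w‖ * ‖f‖ := by
    calc ‖w‖ * ‖w‖ = inner ℝ w w := (real_inner_self_eq_norm_mul_norm w).symm
      _ = inner ℝ (S f) (w - U.starProjection w) := inner_sub_starProjection U _ _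
      _ = inner ℝ f (T (w - U.starProjection w)) := by
          rw [hST, ContinuousLinearMap.adjoint_inner_left]
      _ ≤ ‖f‖ * ‖T (w - U.starProjection w)‖ := real_inner_le_norm _ _
      _ ≤ ‖f‖ * (s * ‖w‖) := by gcongr; exact h w
      _ = s * ‖w‖ * ‖f‖ := by ring
  rcases (norm_nonneg w).eq_or_lt with h0 | h0
  · have := (norm_nonneg _).trans (h f)
    rwa [← h0]
  · nlinarith

end Projection

/-! ### Propagation of the error bound through the spaces and classes -/

section Approximation

variable {H : Type*} [NormedAddCommGroup H] [InnerProductSpace ℝ H] [CompleteSpace H]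

/-- Duality turns the bound for `T` and the previous space into a bound on `S (I - P)`, and `S (P
f)` is a competitor in the next space. The induction alternates between the two families, hence the
quantification over `S`, `T`, `V`, `W`. -/
theorem norm_sub_starProjection_approxSpace_le {s : ℝ} (p : ℕ) : ∀ {S T : H →L[ℝ] H}
    (_ : S = ContinuousLinearMap.adjoint T) (V W : Submodule ℝ H)
    [FiniteDimensional ℝ V] [FiniteDimensional ℝ W]
    (_ : ∀ f, ‖S f - V.starProjection (S f)‖ ≤ s * ‖f‖)
    (_ : ∀ f, ‖T f - W.starProjection (T f)‖ ≤ s * ‖f‖) (f : H),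
    ‖S f - (approxSpace S T V W p).starProjection (S f)‖ ≤ s * ‖f‖ := by
  induction p with
  | zero => intro S T _ V W _ _ hV _ f; exact hV f
  | succ p ih =>
    intro S T hST V W _ _ hV hW f
    have hTS : T = ContinuousLinearMap.adjoint S := by simp [hST]
    have h1 := norm_adjoint_sub_starProjection_le hTS (approxSpace T S W V p)
      (ih hTS W V hW hV) f
    rw [map_sub] at h1
    exact (norm_sub_starProjection_le_of_mem _
      (Submodule.mem_map_of_mem (Submodule.starProjection_apply_mem _ f)) _).trans h1

/-- Apply `‖S (I - P)‖ ≤ s` to the vector `(I - P) f`, which `I - P` fixes. Having the error of `f`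
on the right, rather than `‖f‖`, is what produces powers of `s`. -/
theorem norm_apply_sub_starProjection_approxSpace_le {s : ℝ} {S T : H →L[ℝ] H}
    (hST : S = ContinuousLinearMap.adjoint T) (V W : Submodule ℝ H)
    [FiniteDimensional ℝ V] [FiniteDimensional ℝ W]
    (hV : ∀ f, ‖S f - V.starProjection (S f)‖ ≤ s * ‖f‖)
    (hW : ∀ f, ‖T f - W.starProjection (T f)‖ ≤ s * ‖f‖) (p : ℕ) (f : H) :
    ‖S (f - (approxSpace T S W V p).starProjection f)‖
      ≤ s * ‖f - (approxSpace T S W V p).starProjection f‖ := by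
  have hTS : T = ContinuousLinearMap.adjoint S := by simp [hST]
  have h := norm_adjoint_sub_starProjection_le hTS (approxSpace T S W V p)
    (norm_sub_starProjection_approxSpace_le p hTS W V hW hV)
    (f - (approxSpace T S W V p).starProjection f)
  rwa [starProjection_sub_self, sub_zero] at h

/-- `E(A^r, X_p) ≤ s ^ r` whenever `r ≤ p + 1`. -/
theorem norm_sub_starProjection_le_pow_of_mem_funClass {s : ℝ} (hs : 0 ≤ s) (r : ℕ) :
    ∀ {S T : H →L[ℝ] H} (_ : S = ContinuousLinearMap.adjoint T) (V W : Submodule ℝ H)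
    [FiniteDimensional ℝ V] [FiniteDimensional ℝ W]
    (_ : ∀ f, ‖S f - V.starProjection (S f)‖ ≤ s * ‖f‖)
    (_ : ∀ f, ‖T f - W.starProjection (T f)‖ ≤ s * ‖f‖) (p : ℕ) (_ : r ≤ p + 1)
    (u : H) (_ : u ∈ funClass S T r),
    ‖u - (approxSpace S T V W p).starProjection u‖ ≤ s ^ r := by
  induction r with
  | zero =>
    intro S T _ V W _ _ _ _ p _ u hu
    rw [funClass] at hu
    simpa using (norm_sub_starProjection_le _ u).trans hu.1
  | succ r ih =>
    intro S T hST V W _ _ hV hW p hp u hu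
    have hTS : T = ContinuousLinearMap.adjoint S := by simp [hST]
    cases r with
    | zero =>
      rw [funClass] at hu
      obtain ⟨f, hf, rfl⟩ := hu
      have h := norm_sub_starProjection_approxSpace_le p hST V W hV hW f
      rw [mem_closedBall_zero_iff] at hf
      rw [zero_add, pow_one]
      exact h.trans (mul_le_of_le_one_right hs hf)
    | succ r =>
      rw [funClass] at hu
      obtain ⟨f, hf, rfl⟩ := hu
      -- The class has index at least `2` here, so `p ≥ 1` and the approximation space is an image
      -- under `S`.
      obtain ⟨p, rfl⟩ : ∃ q, p = q + 1 := ⟨p - 1, by omega⟩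
      have h1 := norm_apply_sub_starProjection_approxSpace_le hST V W hV hW p f
      have h2 := ih hTS W V hW hV p (by omega) f hf
      rw [map_sub] at h1
      calc _ ≤ _ := norm_sub_starProjection_le_of_mem _
            (Submodule.mem_map_of_mem (Submodule.starProjection_apply_mem _ f)) _
        _ ≤ s * _ := h1
        _ ≤ s * s ^ (r + 1) := by gcongr
        _ = _ := by ring

/-- The Ritz error `u - S Y_q f` of `u = S f`, in `L²`. -/
theorem norm_apply_sub_starProjection_le_pow_of_mem_funClass {s : ℝ} (hs : 0 ≤ s)
    {S T : H →L[ℝ] H} (hST : S = ContinuousLinearMap.adjoint T) (V W : Submodule ℝ H)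
    [FiniteDimensional ℝ V] [FiniteDimensional ℝ W]
    (hV : ∀ f, ‖S f - V.starProjection (S f)‖ ≤ s * ‖f‖)
    (hW : ∀ f, ‖T f - W.starProjection (T f)‖ ≤ s * ‖f‖) {r q : ℕ} (hr : r ≤ q + 1)
    {f : H} (hf : f ∈ funClass T S r) :
    ‖S f - S ((approxSpace T S W V q).starProjection f)‖ ≤ s ^ (r + 1) := by
  have hTS : T = ContinuousLinearMap.adjoint S := by simp [hST]
  rw [← map_sub, pow_succ']
  refine (norm_apply_sub_starProjection_approxSpace_le hST V W hV hW q f).trans ?_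
  gcongr
  exact norm_sub_starProjection_le_pow_of_mem_funClass hs r hTS W V hW hV q hr f hf

/-- Removing the component of `f` in `ker S` changes neither `S f` nor the norm bound. This is
needed because `A^1` is the image of the whole ball, while `∂` is known to invert the operator only
on vectors orthogonal to the kernel. -/
theorem exists_mem_funClass_zero (S T : H →L[ℝ] H) {f : H} (hf : ‖f‖ ≤ 1) :
    ∃ g ∈ funClass T S 0, S g = S f := by
  let N := LinearMap.ker (S : H →ₗ[ℝ] H)
  have : CompleteSpace N := (S.isClosed_ker).completeSpace_coe
  refine ⟨f - N.starProjection f, ?_, ?_⟩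
  · rw [funClass]
    refine ⟨(norm_sub_starProjection_le N f).trans hf, fun w hw => ?_⟩
    exact N.sub_starProjection_mem_orthogonal f w hw
  · have h : S (N.starProjection f) = 0 :=
      LinearMap.mem_ker.1 (Submodule.starProjection_apply_mem N f)
    rw [map_sub, h, sub_zero]

theorem exists_mem_funClass_of_mem_succ {S T : H →L[ℝ] H} {r : ℕ} {u : H}
    (hu : u ∈ funClass S T (r + 1)) : ∃ f ∈ funClass T S r, S f = u := by
  match r, hu with
  | 0, hu =>
    rw [funClass] at hu
    obtain ⟨f, hf, rfl⟩ := hu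
    exact exists_mem_funClass_zero S T (mem_closedBall_zero_iff.1 hf)
  | r + 1, hu =>
    rw [funClass] at hu
    exact hu

/-- The range of `S = T*` is orthogonal to `ker T`, so only the initial space needs a hypothesis. -/
theorem inner_eq_zero_of_mem_approxSpace {S T : H →L[ℝ] H}
    (hST : S = ContinuousLinearMap.adjoint T) (V W : Submodule ℝ H)
    (hV : ∀ x ∈ V, ∀ w, T w = 0 → inner ℝ w x = 0) (p : ℕ) :
    ∀ x ∈ approxSpace S T V W p, ∀ w, T w = 0 → inner ℝ w x = 0 := by
  match p with
  | 0 => exact hV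
  | p + 1 =>
    intro x hx w hw
    rw [approxSpace] at hx
    obtain ⟨y, _, rfl⟩ := hx
    change inner ℝ w (S y) = 0
    rw [hST, ContinuousLinearMap.adjoint_inner_right, hw, inner_zero_left]

end Approximation

/-! ### Top eigenvectors of a compact positive operator -/

section Spectral

variable {H : Type*} [NormedAddCommGroup H] [InnerProductSpace ℝ H]

/-- The norm of a compact positive operator is an eigenvalue. -/
theorem exists_unit_eigenvector_norm [CompleteSpace H] [Nontrivial H] {T : H →L[ℝ] H}
    (hT : IsCompactOperator T) (hsymm : (T : H →ₗ[ℝ] H).IsSymmetric)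
    (hpos : ∀ x, 0 ≤ inner ℝ (T x) x) : ∃ e : H, ‖e‖ = 1 ∧ T e = ‖T‖ • e := by
  suffices h : ∃ e : H, e ≠ 0 ∧ T e = ‖T‖ • e by
    obtain ⟨e, he, hTe⟩ := h
    refine ⟨‖e‖⁻¹ • e, norm_smul_inv_norm he, ?_⟩
    rw [map_smul, hTe, smul_comm]
  by_cases h0 : T = 0
  · obtain ⟨e, he⟩ := exists_ne (0 : H)
    exact ⟨e, he, by simp [h0]⟩
  -- If `‖T‖` were in the resolvent set, the Rayleigh quotients would stay below `‖T‖ - ε`, although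
  -- positivity makes `‖T‖` their supremum.
  have hmem : ‖T‖ ∈ spectrum ℝ T := by
    by_contra hcon
    obtain ⟨ε, hε, hle⟩ := T.rayleighQuotient_le_of_norm_mem_resolventSet (by
      simpa [spectrum] using hcon)
    have h1 : ‖T‖ ≤ ‖T‖ - ε := by
      conv_lhs => rw [T.norm_eq_iSup_rayleighQuotient hsymm]
      refine ciSup_le fun x => ?_
      rw [abs_of_nonneg]
      · exact hle x
      · exact div_nonneg (hpos x) (by positivity)
    linarith
  have hev := (hT.hasEigenvalue_iff_mem_spectrum (norm_ne_zero_iff.2 h0)).2 hmem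
  obtain ⟨e, he⟩ := hev.exists_hasEigenvector
  exact ⟨e, he.2, he.apply_eq_smul⟩

/-- A compact positive operator has a largest eigenvalue on the orthogonal complement of
finitely many eigenvectors. -/
theorem exists_unit_eigenvector_orthogonal [CompleteSpace H] (hH : ¬ FiniteDimensional ℝ H)
    {T : H →L[ℝ] H} (hT : IsCompactOperator T) (hsymm : (T : H →ₗ[ℝ] H).IsSymmetric)
    (hpos : ∀ x, 0 ≤ inner ℝ (T x) x) {n : ℕ} (v : Fin n → H)
    (hv : ∀ i, ∃ ν : ℝ, T (v i) = ν • v i) :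
    ∃ (e : H) (μ : ℝ), ‖e‖ = 1 ∧ (∀ i, inner ℝ e (v i) = 0) ∧ T e = μ • e ∧
      ∀ x, (∀ i, inner ℝ (v i) x = 0) → inner ℝ (T x) x ≤ μ * ‖x‖ ^ 2 := by
  set V := Submodule.span ℝ (Set.range v) with hVdef
  have hVfin : FiniteDimensional ℝ V := FiniteDimensional.span_of_finite ℝ (Set.finite_range v)
  have hmem : ∀ x, x ∈ Vᗮ ↔ ∀ i, inner ℝ (v i) x = 0 := by
    intro x
    rw [Submodule.mem_orthogonal]
    refine ⟨fun h i => h _ (Submodule.subset_span ⟨i, rfl⟩), fun h u hu => ?_⟩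
    induction hu using Submodule.span_induction with
    | mem y hy => obtain ⟨i, rfl⟩ := hy; exact h i
    | zero => simp
    | add y z _ _ hy hz => rw [inner_add_left, hy, hz, add_zero]
    | smul c y _ hy => rw [real_inner_smul_left, hy, mul_zero]
  have hinv : ∀ x ∈ Vᗮ, T x ∈ Vᗮ := by
    intro x hx
    rw [hmem] at hx ⊢
    intro i
    obtain ⟨ν, hν⟩ := hv i
    have h := hsymm (v i) x
    simp only [ContinuousLinearMap.coe_coe] at h
    rw [← h, hν, real_inner_smul_left, hx i, mul_zero]
  have hne : Nontrivial Vᗮ := by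
    rw [Submodule.nontrivial_iff_ne_bot]
    intro hbot
    rw [Submodule.orthogonal_eq_bot_iff] at hbot
    rw [hbot] at hVfin
    exact hH (Submodule.topEquiv.finiteDimensional)
  -- The restriction to the invariant complement is again compact and positive, so its norm is the
  -- eigenvalue sought.
  set R : Vᗮ →L[ℝ] Vᗮ := T.restrict hinv with hR
  obtain ⟨e, he, hRe⟩ := exists_unit_eigenvector_norm (T := R) (hT.restrict' hinv)
    (hsymm.restrict_invariant hinv) (fun x => hpos x)
  refine ⟨e, ‖R‖, he, fun i => ?_, congrArg Subtype.val hRe, fun x hx => ?_⟩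
  · rw [real_inner_comm]
    exact (hmem e).1 e.2 i
  · calc inner ℝ (T x) x ≤ ‖R ⟨x, (hmem x).2 hx⟩‖ * ‖x‖ := real_inner_le_norm _ _
      _ ≤ ‖R‖ * ‖x‖ * ‖x‖ := by gcongr; exact R.le_opNorm ⟨x, (hmem x).2 hx⟩
      _ = ‖R‖ * ‖x‖ ^ 2 := by ring

/-- Greedy choice of eigenvectors. The last clause records the ordering: any eigenvalue found later
on the complement is at most every `ν i`. -/
theorem exists_orthonormal_top_eigenvectors [CompleteSpace H] (hH : ¬ FiniteDimensional ℝ H)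
    {T : H →L[ℝ] H} (hT : IsCompactOperator T) (hsymm : (T : H →ₗ[ℝ] H).IsSymmetric)
    (hpos : ∀ x, 0 ≤ inner ℝ (T x) x) (n : ℕ) :
    ∃ (v : Fin n → H) (ν : Fin n → ℝ), Orthonormal ℝ v ∧ (∀ i, T (v i) = ν i • v i) ∧
      ∀ x, (∀ i, inner ℝ (v i) x = 0) → ∀ i, inner ℝ (T x) x ≤ ν i * ‖x‖ ^ 2 := by
  induction n with
  | zero => exact ⟨Fin.elim0, Fin.elim0, ⟨fun i => i.elim0, fun i => i.elim0⟩,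
      fun i => i.elim0, fun _ _ i => i.elim0⟩
  | succ n ih =>
    obtain ⟨v, ν, hv, hTv, hle⟩ := ih
    obtain ⟨e, μ, he, hev, hTe, hμ⟩ := exists_unit_eigenvector_orthogonal hH hT hsymm hpos v
      (fun i => ⟨_, hTv i⟩)
    refine ⟨Matrix.vecCons e v, Matrix.vecCons μ ν, orthonormal_vecCons_iff.2 ⟨he, hev, hv⟩,
      ?_, ?_⟩
    · refine Fin.cases ?_ fun i => ?_
      · simpa using hTe
      · simpa using hTv i
    · intro x hx
      have hx' : ∀ i, inner ℝ (v i) x = 0 := fun i => by simpa using hx i.succ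
      refine Fin.cases ?_ fun i => ?_
      · simpa using hμ x hx'
      · simpa using hle x hx' i

/-- Makes the real supremum in `nthEigenvalue` an actual upper bound for its set. -/
theorem bddAbove_nthEigenvalue_set (T : H →L[ℝ] H) (n : ℕ) :
    BddAbove {m : ℝ | ∃ v : Fin (n + 1) → H, Orthonormal ℝ v ∧
      ∀ i, ∃ ν : ℝ, m ≤ ν ∧ T (v i) = ν • v i} := by
  refine ⟨‖T‖, ?_⟩
  rintro m ⟨v, hv, h⟩
  obtain ⟨ν, hm, hν⟩ := h 0
  have h1 := T.le_opNorm (v 0)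
  rw [hν, norm_smul, hv.1 0, mul_one, mul_one, Real.norm_eq_abs] at h1
  exact hm.trans ((le_abs_self ν).trans h1)

/-- The first `n` eigenvectors span a space off which the quadratic form of `T` is at most the
next eigenvalue. -/
theorem exists_finrank_eq_inner_le_nthEigenvalue [CompleteSpace H]
    (hH : ¬ FiniteDimensional ℝ H) {T : H →L[ℝ] H} (hT : IsCompactOperator T)
    (hsymm : (T : H →ₗ[ℝ] H).IsSymmetric) (hpos : ∀ x, 0 ≤ inner ℝ (T x) x) (n : ℕ) :
    0 ≤ nthEigenvalue T (n + 1) ∧ ∃ V : Submodule ℝ H, FiniteDimensional ℝ V ∧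
      Module.finrank ℝ V = n ∧
      ∀ x ∈ Vᗮ, inner ℝ (T x) x ≤ nthEigenvalue T (n + 1) * ‖x‖ ^ 2 := by
  obtain ⟨v, ν, hv, hTv, hle⟩ := exists_orthonormal_top_eigenvectors hH hT hsymm hpos n
  obtain ⟨e, μ, he, hev, hTe, hμ⟩ := exists_unit_eigenvector_orthogonal hH hT hsymm hpos v
    (fun i => ⟨_, hTv i⟩)
  have hTee : inner ℝ (T e) e = μ := by
    rw [hTe, real_inner_smul_left, real_inner_self_eq_norm_sq, he]; norm_num
  have hμν : ∀ i, μ ≤ ν i := fun i => by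
    have := hle e (fun j => by rw [real_inner_comm]; exact hev j) i
    rwa [hTee, he, one_pow, mul_one] at this
  -- Only this inequality is needed: `e` and the `v i` are `n + 1` orthonormal eigenvectors with
  -- eigenvalues at least `μ`.
  have hμle : μ ≤ nthEigenvalue T (n + 1) := by
    refine le_csSup (bddAbove_nthEigenvalue_set T n)
      ⟨Matrix.vecCons e v, orthonormal_vecCons_iff.2 ⟨he, hev, hv⟩, ?_⟩
    refine Fin.cases ⟨μ, le_rfl, by simpa using hTe⟩ fun i => ⟨ν i, hμν i, by simpa using hTv i⟩
  refine ⟨(hTee ▸ hpos e).trans hμle, Submodule.span ℝ (Set.range v),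
    FiniteDimensional.span_of_finite ℝ (Set.finite_range v), ?_, fun x hx => ?_⟩
  · simpa using finrank_span_eq_card hv.linearIndependent
  · refine (hμ x fun i => hx _ (Submodule.subset_span ⟨i, rfl⟩)).trans ?_
    gcongr

end Spectral

/-! ### Upper bound for the widths -/

section Width

variable {H : Type*} [NormedAddCommGroup H] [InnerProductSpace ℝ H]

/-- `nWidth` ranges over subspaces of dimension exactly `n`, whereas `K(V)` may have smaller
dimension and must be padded. -/
theorem exists_le_finrank_eq (hH : ¬ FiniteDimensional ℝ H) {n : ℕ} (U : Submodule ℝ H)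
    [FiniteDimensional ℝ U] (hU : Module.finrank ℝ U ≤ n) :
    ∃ U' : Submodule ℝ H, U ≤ U' ∧ FiniteDimensional ℝ U' ∧ Module.finrank ℝ U' = n := by
  induction n, hU using Nat.le_induction with
  | base => exact ⟨U, le_rfl, inferInstance, rfl⟩
  | succ n _ ih =>
    obtain ⟨U', hle, hfin, hrank⟩ := ih
    obtain ⟨x, hx⟩ : ∃ x, x ∉ U' := by
      by_contra! h
      rw [(Submodule.eq_top_iff'.2 h)] at hfin
      exact hH (Submodule.topEquiv.finiteDimensional)
    refine ⟨U' ⊔ Submodule.span ℝ {x}, hle.trans le_sup_left, inferInstance, ?_⟩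
    have hx0 : x ≠ 0 := fun h => hx (h ▸ U'.zero_mem)
    have hinf : U' ⊓ Submodule.span ℝ {x} = ⊥ :=
      (Submodule.disjoint_span_singleton' hx0).2 hx |>.eq_bot
    have h := Submodule.finrank_sup_add_finrank_inf_eq U' (Submodule.span ℝ {x})
    rw [hinf, finrank_bot, finrank_span_singleton hx0, hrank] at h
    simpa using h

theorem approxError_image_closedBall_le (S : H →L[ℝ] H) (U : Submodule ℝ H)
    [FiniteDimensional ℝ U] {s : ℝ} (hs : 0 ≤ s)
    (h : ∀ f, ‖S f - U.starProjection (S f)‖ ≤ s * ‖f‖) :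
    approxError (S '' Metric.closedBall 0 1) U ≤ ENNReal.ofReal s := by
  refine iSup₂_le ?_
  rintro _ ⟨f, hf, rfl⟩
  rw [← ofReal_norm]
  exact ENNReal.ofReal_le_ofReal
    ((h f).trans (mul_le_of_le_one_right hs (mem_closedBall_zero_iff.1 hf)))

theorem norm_sub_starProjection_le_of_approxError_le (S : H →L[ℝ] H) (U : Submodule ℝ H)
    [FiniteDimensional ℝ U] {s : ℝ} (hs : 0 ≤ s)
    (h : approxError (S '' Metric.closedBall 0 1) U ≤ ENNReal.ofReal s) (f : H) :
    ‖S f - U.starProjection (S f)‖ ≤ s * ‖f‖ := by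
  rcases eq_or_ne f 0 with rfl | hf
  · simp
  have hf' : 0 < ‖f‖ := norm_pos_iff.2 hf
  have h1 : ‖S (‖f‖⁻¹ • f) - U.starProjection (S (‖f‖⁻¹ • f))‖ₑ ≤ ENNReal.ofReal s :=
    le_trans (le_iSup₂_of_le (f := fun u (_ : u ∈ S '' Metric.closedBall 0 1) =>
      ‖u - U.starProjection u‖ₑ) _ ⟨‖f‖⁻¹ • f, by simp [norm_smul, hf'.ne'], rfl⟩ le_rfl) h
  rw [← ofReal_norm, ENNReal.ofReal_le_ofReal_iff hs, map_smul, map_smul, ← smul_sub,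
    norm_smul, norm_inv, norm_norm, inv_mul_le_iff₀ hf'] at h1
  linarith

theorem IsOptimal.norm_sub_starProjection_le {n : ℕ} {S : H →L[ℝ] H} {X : Submodule ℝ H}
    [FiniteDimensional ℝ X] (hX : IsOptimal n (S '' Metric.closedBall 0 1) X)
    {s : ℝ} (hs : 0 ≤ s) (U : Submodule ℝ H) [FiniteDimensional ℝ U]
    (hU : Module.finrank ℝ U = n)
    (h : ∀ f, ‖S f - U.starProjection (S f)‖ ≤ s * ‖f‖) (f : H) :
    ‖S f - X.starProjection (S f)‖ ≤ s * ‖f‖ := by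
  refine norm_sub_starProjection_le_of_approxError_le S X hs ?_ f
  rw [← hX.2]
  exact (iInf_le_of_le U (iInf₂_le_of_le ‹_› hU le_rfl)).trans
    (approxError_image_closedBall_le S U hs h)

variable [CompleteSpace H]

/-- Since `⟪K* K x, x⟫ = ‖K x‖²`, the spectral bound off `V` reads `‖K (I - P_V)‖ ≤ √l`. It serves
both widths, through `K(V)` and through the adjoint, so the eigenvalues of `K K*` never enter. -/
theorem IsOptimal.norm_sub_starProjection_le_sqrt_nthEigenvalue (hH : ¬ FiniteDimensional ℝ H)
    {K : H →L[ℝ] H} (hK : IsCompactOperator K) {n : ℕ} {X Y : Submodule ℝ H}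
    [FiniteDimensional ℝ X] [FiniteDimensional ℝ Y]
    (hX : IsOptimal n (K '' Metric.closedBall 0 1) X)
    (hY : IsOptimal n (ContinuousLinearMap.adjoint K '' Metric.closedBall 0 1) Y) :
    let l := nthEigenvalue ((ContinuousLinearMap.adjoint K).comp K) (n + 1)
    0 ≤ l ∧ (∀ f, ‖K f - X.starProjection (K f)‖ ≤ √l * ‖f‖) ∧
      ∀ f, ‖ContinuousLinearMap.adjoint K f - Y.starProjection (ContinuousLinearMap.adjoint K f)‖
        ≤ √l * ‖f‖ := by
  intro l
  have hform : ∀ x y, inner ℝ (((ContinuousLinearMap.adjoint K).comp K) x) y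
      = inner ℝ (K x) (K y) := fun x y => by
    rw [ContinuousLinearMap.comp_apply, ContinuousLinearMap.adjoint_inner_left]
  obtain ⟨hl, V, hVfin, hVrank, hV⟩ := exists_finrank_eq_inner_le_nthEigenvalue hH
    (T := (ContinuousLinearMap.adjoint K).comp K)
    (hK.clm_comp (ContinuousLinearMap.adjoint K))
    (fun x y => by
      simp only [ContinuousLinearMap.coe_coe]
      rw [hform, ContinuousLinearMap.comp_apply, ContinuousLinearMap.adjoint_inner_right])
    (fun x => by rw [hform]; exact real_inner_self_nonneg) n
  have hKV : ∀ f, ‖K (f - V.starProjection f)‖ ≤ √l * ‖f‖ := fun f => by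
    have h := hV _ (V.sub_starProjection_mem_orthogonal f)
    rw [hform, real_inner_self_eq_norm_sq] at h
    calc ‖K (f - V.starProjection f)‖ = √(‖K (f - V.starProjection f)‖ ^ 2) :=
          (Real.sqrt_sq (norm_nonneg _)).symm
      _ ≤ √(l * ‖f - V.starProjection f‖ ^ 2) := Real.sqrt_le_sqrt h
      _ = √l * ‖f - V.starProjection f‖ := by
          rw [Real.sqrt_mul hl, Real.sqrt_sq (norm_nonneg _)]
      _ ≤ √l * ‖f‖ := by gcongr; exact RitzWidth.norm_sub_starProjection_le V f
  refine ⟨hl, ?_, ?_⟩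
  · obtain ⟨U, hle, hUfin, hUrank⟩ := exists_le_finrank_eq hH (V.map (K : H →ₗ[ℝ] H))
      ((Submodule.finrank_map_le _ _).trans hVrank.le)
    refine hX.norm_sub_starProjection_le (Real.sqrt_nonneg l) U hUrank fun f => ?_
    refine (norm_sub_starProjection_le_of_mem U
      (hle (Submodule.mem_map_of_mem (V.starProjection_apply_mem f))) _).trans ?_
    have := hKV f
    rwa [map_sub] at this
  · exact hY.norm_sub_starProjection_le (Real.sqrt_nonneg l) V hVrank
      (norm_sub_starProjection_adjoint_le rfl V hKV)

end Width

/-! ### Compactness of the integral operator -/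

section HilbertSchmidt

/-- By Cauchy-Schwarz and Bessel, `T` is the operator-norm limit of the finite-rank truncations of
its expansion in the basis. -/
theorem isCompactOperator_of_summable_norm_sq {ι H F : Type*} [NormedAddCommGroup H]
    [InnerProductSpace ℝ H] [NormedAddCommGroup F] [NormedSpace ℝ F] [CompleteSpace F]
    (b : HilbertBasis ι ℝ H) (T : H →L[ℝ] F) (h : Summable fun i => ‖T (b i)‖ ^ 2) :
    IsCompactOperator T := by
  classical
  let F₀ : Finset ι → H →L[ℝ] F := fun s =>
    ∑ i ∈ s, (innerSL ℝ (b i)).smulRight (T (b i))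
  have hF₀ : ∀ s x, F₀ s x = ∑ i ∈ s, (inner ℝ (b i) x : ℝ) • T (b i) := fun s x => by
    simp [F₀]
  have hsum : ∀ x, HasSum (fun i => (inner ℝ (b i) x : ℝ) • T (b i)) (T x) := fun x => by
    have := (b.hasSum_repr x).mapL T
    simpa only [map_smul, b.repr_apply_apply] using this
  have hcauchy : ∀ (t : Finset ι) (x : H),
      ‖∑ i ∈ t, (inner ℝ (b i) x : ℝ) • T (b i)‖ ≤ √(∑ i ∈ t, ‖T (b i)‖ ^ 2) * ‖x‖ := by
    intro t x
    calc ‖∑ i ∈ t, (inner ℝ (b i) x : ℝ) • T (b i)‖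
        ≤ ∑ i ∈ t, ‖T (b i)‖ * ‖(inner ℝ (b i) x : ℝ)‖ := by
          refine (norm_sum_le _ _).trans_eq (Finset.sum_congr rfl fun i _ => ?_)
          rw [norm_smul, mul_comm]
      _ ≤ √(∑ i ∈ t, ‖T (b i)‖ ^ 2) * √(∑ i ∈ t, ‖(inner ℝ (b i) x : ℝ)‖ ^ 2) :=
          Real.sum_mul_le_sqrt_mul_sqrt _ _ _
      _ ≤ √(∑ i ∈ t, ‖T (b i)‖ ^ 2) * ‖x‖ := by
          gcongr
          exact Real.sqrt_le_iff.2 ⟨norm_nonneg x, b.orthonormal.sum_inner_products_le x⟩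
  have htend : Filter.Tendsto F₀ Filter.atTop (nhds T) := by
    rw [Metric.tendsto_atTop]
    intro ε hε
    obtain ⟨s, hs⟩ := summable_iff_vanishing_norm.1 h ((ε / 2) ^ 2) (by positivity)
    refine ⟨s, fun s' hs' => ?_⟩
    rw [dist_comm, dist_eq_norm]
    refine lt_of_le_of_lt (ContinuousLinearMap.opNorm_le_bound _ (half_pos hε).le fun x => ?_)
      (half_lt_self hε)
    rw [sub_apply, hF₀]
    -- The tail at `x` is a limit of sums over `t \ s'`, finite sets disjoint from `s`, each
    -- controlled by `hs`.
    refine le_of_tendsto (((hsum x).sub_const _).norm) ?_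
    filter_upwards [Filter.eventually_ge_atTop s'] with t ht
    rw [← Finset.sum_sdiff ht, add_sub_cancel_right]
    refine (hcauchy _ x).trans ?_
    gcongr
    refine Real.sqrt_le_iff.2 ⟨(half_pos hε).le, ?_⟩
    have h1 := hs (t \ s') (Finset.sdiff_disjoint.mono_right hs')
    exact (le_abs_self _).trans h1.le
  refine isCompactOperator_of_tendsto htend (Filter.Eventually.of_forall fun s => ?_)
  refine Finset.sum_induction (fun i => (innerSL ℝ (b i)).smulRight (T (b i)))
    (fun A : H →L[ℝ] F => IsCompactOperator A) (fun A B hA hB => hA.add hB)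
    isCompactOperator_zero fun i _ => ?_
  have h1 : IsCompactOperator ((ContinuousLinearMap.id ℝ ℝ).smulRight (T (b i))) :=
    isCompactOperator_of_locallyCompactSpace_rng _
  exact h1.comp_clm (innerSL ℝ (b i))

theorem eLpNorm_two_sq {μ : Measure ℝ} (f : ℝ → ℝ) :
    eLpNorm f 2 μ ^ 2 = ∫⁻ x, ‖f x‖ₑ ^ 2 ∂μ := by
  rw [eLpNorm_eq_lintegral_rpow_enorm_toReal (by norm_num) (by norm_num), ← ENNReal.rpow_two,
    ← ENNReal.rpow_mul]
  simp

theorem sum_enorm_kernel_sq_le {μ : Measure ℝ} {ι : Type*} {e : ι → Lp ℝ 2 μ} (he : Orthonormal ℝ e)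
    {g : ℝ → ℝ} (hg : MemLp g 2 μ) (s : Finset ι) :
    ∑ i ∈ s, ‖∫ y, g y * e i y ∂μ‖ₑ ^ 2 ≤ ∫⁻ y, ‖g y‖ₑ ^ 2 ∂μ := by
  have hin : ∀ i, ∫ y, g y * e i y ∂μ = inner ℝ (e i) (hg.toLp g) := fun i => by
    rw [L2.inner_def]
    refine integral_congr_ae ?_
    filter_upwards [hg.coeFn_toLp] with y hy
    rw [hy]
    simp
  have h := he.sum_inner_products_le (hg.toLp g) (s := s)
  calc ∑ i ∈ s, ‖∫ y, g y * e i y ∂μ‖ₑ ^ 2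
      = ENNReal.ofReal (∑ i ∈ s, ‖inner ℝ (e i) (hg.toLp g)‖ ^ 2) := by
        rw [ENNReal.ofReal_sum_of_nonneg fun i _ => by positivity]
        refine Finset.sum_congr rfl fun i _ => ?_
        rw [hin, ENNReal.ofReal_pow (norm_nonneg _), ofReal_norm]
    _ ≤ ENNReal.ofReal (‖hg.toLp g‖ ^ 2) := ENNReal.ofReal_le_ofReal h
    _ = ∫⁻ y, ‖g y‖ₑ ^ 2 ∂μ := by
        rw [ENNReal.ofReal_pow (norm_nonneg _), ofReal_norm, Lp.enorm_toLp,
          eLpNorm_two_sq]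

variable {μ : Measure ℝ} [SFinite μ]

/-- Bessel's inequality for almost every section `k x`, integrated over `x`. -/
theorem sum_norm_integralOp_sq_le {k : ℝ → ℝ → ℝ}
    (hk : MemLp (Function.uncurry k) 2 (μ.prod μ)) {ι : Type*} {e : ι → Lp ℝ 2 μ}
    (he : Orthonormal ℝ e) (s : Finset ι) :
    ∑ i ∈ s, ‖integralOp k hk (e i)‖ ^ 2
      ≤ (∫⁻ x, ∫⁻ y, ‖k x y‖ₑ ^ 2 ∂μ ∂μ).toReal := by
  have hfin : ∫⁻ x, ∫⁻ y, ‖k x y‖ₑ ^ 2 ∂μ ∂μ ≠ ⊤ := by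
    have h := lintegral_rpow_enorm_lt_top_of_eLpNorm_lt_top (by norm_num) (by norm_num) hk.2
    rw [lintegral_prod _ (hk.1.enorm.pow_const _)] at h
    simpa [Function.uncurry] using h.ne
  rw [← ENNReal.ofReal_le_iff_le_toReal hfin,
    ENNReal.ofReal_sum_of_nonneg fun i _ => by positivity]
  calc ∑ i ∈ s, ENNReal.ofReal (‖integralOp k hk (e i)‖ ^ 2)
      = ∑ i ∈ s, ∫⁻ x, ‖∫ y, k x y * e i y ∂μ‖ₑ ^ 2 ∂μ := by
        refine Finset.sum_congr rfl fun i _ => ?_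
        rw [ENNReal.ofReal_pow (norm_nonneg _), ofReal_norm, Lp.enorm_def, eLpNorm_two_sq]
        refine lintegral_congr_ae ?_
        filter_upwards [integralOp_coeFn k hk (e i)] with x hx
        rw [hx]
    _ = ∫⁻ x, ∑ i ∈ s, ‖∫ y, k x y * e i y ∂μ‖ₑ ^ 2 ∂μ := by
        refine (lintegral_finsetSum' _ fun i _ => ?_).symm
        exact (kernel_memLp hk (Lp.memLp (e i))).1.enorm.pow_const 2
    _ ≤ ∫⁻ x, ∫⁻ y, ‖k x y‖ₑ ^ 2 ∂μ ∂μ := by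
        refine lintegral_mono_ae ?_
        filter_upwards [kernel_ae_section hk] with x hx
        exact sum_enorm_kernel_sq_le he hx s

/-- An integral operator with square-integrable kernel is compact. -/
theorem isCompactOperator_integralOp {k : ℝ → ℝ → ℝ}
    (hk : MemLp (Function.uncurry k) 2 (μ.prod μ)) : IsCompactOperator (integralOp k hk) := by
  obtain ⟨w, b, -⟩ := exists_hilbertBasis ℝ (Lp ℝ 2 μ)
  exact isCompactOperator_of_summable_norm_sq b _
    (summable_of_sum_le (fun i => by positivity)
      fun s => sum_norm_integralOp_sq_le hk b.orthonormal s)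

end HilbertSchmidt

/-! ### Infinite dimension of `L²(a, b)` and weak derivatives -/

section Interval

variable {a b : ℝ}

theorem not_finiteDimensional_L2 (hab : a < b) : ¬ FiniteDimensional ℝ (L2 a b) := by
  intro hfin
  -- Starting at `b` and decreasing towards `a`; indicators of the successive gaps form an infinite
  -- orthogonal family.
  let f : ℕ → ℝ := fun n => a + (b - a) / (n + 1)
  have hanti : StrictAnti f := strictAnti_nat_of_succ_lt fun n => by
    have : 0 < b - a := sub_pos.2 hab
    simp only [f]
    gcongr
    linarith
  have hsub : ∀ n, Set.Ioo (f (n + 1)) (f n) ⊆ Set.Ioo a b := fun n x hx => by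
    have hpos : 0 < b - a := sub_pos.2 hab
    constructor
    · refine lt_trans ?_ hx.1
      simp only [f, lt_add_iff_pos_right]
      positivity
    · refine hx.2.trans_le ((hanti.antitone (Nat.zero_le n)).trans_eq ?_)
      simp [f]
  have hvol : ∀ n, vol a b (Set.Ioo (f (n + 1)) (f n)) = ENNReal.ofReal (f n - f (n + 1)) :=
    fun n => by
      rw [Measure.restrict_apply measurableSet_Ioo, Set.inter_eq_left.2 (hsub n),
        Real.volume_Ioo]
  let v : ℕ → L2 a b := fun n => indicatorConstLp 2 (measurableSet_Ioo (a := f (n + 1))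
    (b := f n)) (measure_ne_top _ _) (1 : ℝ)
  have hinner : ∀ m n, inner ℝ (v m) (v n)
      = (vol a b).real (Set.Ioo (f (m + 1)) (f m) ∩ Set.Ioo (f (n + 1)) (f n)) := fun m n => by
    simp only [v]
    rw [L2.inner_indicatorConstLp_indicatorConstLp]
    simp
  have hli : LinearIndependent ℝ v := by
    refine linearIndependent_of_ne_zero_of_inner_eq_zero (fun n h0 => ?_) fun m n hmn => ?_
    · have h := hinner n n
      rw [h0, inner_zero_left, Set.inter_self, Measure.real, hvol, ENNReal.toReal_ofReal] at h
      · have := hanti (Nat.lt_succ_self n)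
        simp only [Nat.succ_eq_add_one] at this
        linarith
      · exact (sub_pos.2 (hanti (Nat.lt_succ_self n))).le
    · change inner ℝ (v m) (v n) = 0
      rw [hinner]
      have := hanti.antitone.pairwise_disjoint_on_Ioo_succ hmn
      rw [Function.onFun, Set.disjoint_iff_inter_eq_empty] at this
      simp only [Nat.succ_eq_succ, Nat.succ_eq_add_one] at this
      rw [this, measureReal_empty]
  exact not_finite_iff_infinite.2 (inferInstance : Infinite ℕ) hli.finite

theorem integrable_mul_of_hasCompactSupport (u : L2 a b) {φ : ℝ → ℝ} (hφ : Continuous φ)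
    (hc : HasCompactSupport φ) : Integrable (fun x => u x * φ x) (vol a b) :=
  (Lp.memLp u).integrable_mul (q := 2) (hφ.memLp_of_hasCompactSupport hc)

/-- The fundamental lemma of the calculus of variations; it makes the choice inside `weakDeriv`
harmless. -/
theorem HasWeakDeriv.unique {u v w : L2 a b} (hv : HasWeakDeriv u v) (hw : HasWeakDeriv u w) :
    v = w := by
  have hint : Integrable (fun x => v x - w x) (vol a b) :=
    ((Lp.memLp v).integrable (by norm_num)).sub ((Lp.memLp w).integrable (by norm_num))
  have h := isOpen_Ioo.ae_eq_zero_of_integral_contDiff_smul_eq_zero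
    (μ := vol a b) (U := Set.Ioo a b) (f := fun x => v x - w x)
    (hint.locallyIntegrable.locallyIntegrableOn _) (fun φ hφ hc hs => by
      have h1 := (hv φ hφ hc hs).symm.trans (hw φ hφ hc hs)
      have h2 := integral_sub (integrable_mul_of_hasCompactSupport v hφ.continuous hc)
        (integrable_mul_of_hasCompactSupport w hφ.continuous hc)
      rw [neg_injective h1, sub_self] at h2
      rw [← h2]
      refine integral_congr_ae (Filter.Eventually.of_forall fun x => ?_)
      simp only [smul_eq_mul]
      ring)
  refine Lp.ext ?_
  filter_upwards [h, ae_restrict_mem measurableSet_Ioo] with x hx hmem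
  exact sub_eq_zero.1 (hx hmem)

theorem HasWeakDeriv.weakDeriv_eq {u v : L2 a b} (h : HasWeakDeriv u v) : weakDeriv u = v := by
  have hu : MemH1 u := ⟨v, h⟩
  rw [weakDeriv, dif_pos hu]
  exact hu.choose_spec.unique h

theorem HasWeakDeriv.const_smul {u v : L2 a b} (h : HasWeakDeriv u v) (c : ℝ) :
    HasWeakDeriv (c • u) (c • v) := by
  intro φ hφ hc hs
  have hsmul : ∀ (w : L2 a b) (ψ : ℝ → ℝ),
      ∫ x in Set.Ioo a b, (c • w : L2 a b) x * ψ x = c * ∫ x in Set.Ioo a b, w x * ψ x := by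
    intro w ψ
    rw [← integral_const_mul]
    refine integral_congr_ae ?_
    filter_upwards [Lp.coeFn_smul c w] with x hx
    rw [hx, Pi.smul_apply, smul_eq_mul, mul_assoc]
  rw [hsmul, hsmul, h φ hφ hc hs, mul_neg]

/-- A relation `∂ S f = ± f` on the unit ball of `(ker S)ᗮ` extends to all of `(ker S)ᗮ`. -/
theorem hasWeakDeriv_of_forall_mem_funClass_zero {S T : L2 a b →L[ℝ] L2 a b} {c : ℝ}
    (h : ∀ f ∈ funClass T S 0, HasWeakDeriv (S f) (c • f)) {f : L2 a b}
    (hf : ∀ w, S w = 0 → inner ℝ w f = 0) : HasWeakDeriv (S f) (c • f) := by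
  rcases eq_or_ne f 0 with rfl | hf0
  · exact h 0 (by rw [funClass]; simp)
  have hne : ‖f‖ ≠ 0 := norm_ne_zero_iff.2 hf0
  have h1 := (h (‖f‖⁻¹ • f) (by
    rw [funClass]
    refine ⟨(norm_smul_inv_norm hf0).le, fun w hw => ?_⟩
    rw [real_inner_smul_right, hf w hw, mul_zero])).const_smul ‖f‖
  rwa [map_smul, smul_comm c, smul_inv_smul₀ hne, smul_inv_smul₀ hne] at h1

end Interval

/-! ### Ritz estimates and the main theorem -/

section Ritz

variable {a b : ℝ}

/-- The Ritz estimates for `u ∈ A^(r+1)` and a map `R` with `R (S f) = S Y_q f`, when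
`∂ S = c I`, `|c| = 1`. -/
theorem ritz_estimates {S T : L2 a b →L[ℝ] L2 a b} (hST : S = ContinuousLinearMap.adjoint T)
    {c : ℝ} (hc : |c| = 1)
    (hderiv : ∀ r : ℕ, ∀ f ∈ funClass T S r, HasWeakDeriv (S f) (c • f))
    {s : ℝ} (hs : 0 ≤ s) (V W : Submodule ℝ (L2 a b)) [FiniteDimensional ℝ V]
    [FiniteDimensional ℝ W] (hWker : ∀ y ∈ W, ∀ w, S w = 0 → inner ℝ w y = 0)
    (hV : ∀ f, ‖S f - V.starProjection (S f)‖ ≤ s * ‖f‖)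
    (hW : ∀ f, ‖T f - W.starProjection (T f)‖ ≤ s * ‖f‖)
    {r q : ℕ} (hr : r ≤ q + 1) (R : L2 a b → L2 a b)
    (hR : ∀ f ∈ funClass T S r, R (S f) = S ((approxSpace T S W V q).starProjection f))
    {u : L2 a b} (hu : u ∈ funClass S T (r + 1)) :
    MemH1 u ∧ MemH1 (R u) ∧ ‖u - R u‖ ≤ s ^ (r + 1) ∧
      ‖weakDeriv u - weakDeriv (R u)‖ ≤ s ^ r := by
  have hTS : T = ContinuousLinearMap.adjoint S := by simp [hST]
  obtain ⟨f, hf, rfl⟩ := exists_mem_funClass_of_mem_succ hu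
  have h1 := hderiv r f hf
  -- The projection of `f` need not lie in the class of `f`, but it is orthogonal to `ker S`, which
  -- suffices to differentiate its image.
  have h2 := hasWeakDeriv_of_forall_mem_funClass_zero (hderiv 0)
    (inner_eq_zero_of_mem_approxSpace hTS W V hWker q _
      (Submodule.starProjection_apply_mem (approxSpace T S W V q) f))
  rw [hR f hf]
  refine ⟨⟨_, h1⟩, ⟨_, h2⟩,
    norm_apply_sub_starProjection_le_pow_of_mem_funClass hs hST V W hV hW hr hf, ?_⟩
  rw [h1.weakDeriv_eq, h2.weakDeriv_eq, ← smul_sub, norm_smul, Real.norm_eq_abs, hc, one_mul]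
  exact norm_sub_starProjection_le_pow_of_mem_funClass hs r hTS W V hW hV q hr f hf

end Ritz

end RitzWidth

theorem mainTheorem4 (a b : ℝ) (hab : a < b) (k : ℝ → ℝ → ℝ)
    (hk : MemLp (Function.uncurry k) 2 ((RitzWidth.vol a b).prod (RitzWidth.vol a b)))
    (K : RitzWidth.L2 a b →L[ℝ] RitzWidth.L2 a b) (hK : K = RitzWidth.integralOp k hk)
    (hderiv : RitzWidth.DerivInverse K)
    (n : ℕ)
    (X₀ Y₀ : Submodule ℝ (RitzWidth.L2 a b))
    [FiniteDimensional ℝ X₀] [FiniteDimensional ℝ Y₀]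
    (hX₀ker : ∀ x ∈ X₀, ∀ w, ContinuousLinearMap.adjoint K w = 0 → inner ℝ w x = 0)
    (hY₀ker : ∀ y ∈ Y₀, ∀ w, K w = 0 → inner ℝ w y = 0)
    (hX₀ : RitzWidth.IsOptimal n (RitzWidth.classA K 1) X₀)
    (hY₀ : RitzWidth.IsOptimal n (RitzWidth.classAstar K 1) Y₀)
    (r p : ℕ) (hr : 1 ≤ r) (hp : max 1 (r - 1) ≤ p) :
    (∀ u ∈ RitzWidth.classA K r,
      RitzWidth.MemH1 u ∧ RitzWidth.MemH1 (RitzWidth.ritzX K X₀ Y₀ p u) ∧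
      ‖u - RitzWidth.ritzX K X₀ Y₀ p u‖ ≤ RitzWidth.eigval K (n + 1) ^ ((r : ℝ) / 2) ∧
      ‖RitzWidth.weakDeriv u - RitzWidth.weakDeriv (RitzWidth.ritzX K X₀ Y₀ p u)‖
        ≤ RitzWidth.eigval K (n + 1) ^ (((r : ℝ) - 1) / 2)) ∧
    (∀ u ∈ RitzWidth.classAstar K r,
      RitzWidth.MemH1 u ∧ RitzWidth.MemH1 (RitzWidth.ritzY K X₀ Y₀ p u) ∧
      ‖u - RitzWidth.ritzY K X₀ Y₀ p u‖ ≤ RitzWidth.eigval K (n + 1) ^ ((r : ℝ) / 2) ∧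
      ‖RitzWidth.weakDeriv u - RitzWidth.weakDeriv (RitzWidth.ritzY K X₀ Y₀ p u)‖
        ≤ RitzWidth.eigval K (n + 1) ^ (((r : ℝ) - 1) / 2)) := by
  subst hK
  set K := RitzWidth.integralOp k hk
  obtain ⟨hl, hV, hW⟩ := RitzWidth.IsOptimal.norm_sub_starProjection_le_sqrt_nthEigenvalue
    (RitzWidth.not_finiteDimensional_L2 hab) (RitzWidth.isCompactOperator_integralOp hk) hX₀ hY₀
  change 0 ≤ RitzWidth.eigval K (n + 1) at hl
  obtain ⟨r, rfl⟩ : ∃ m, r = m + 1 := ⟨r - 1, by omega⟩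
  obtain ⟨q, rfl⟩ : ∃ m, p = m + 1 := ⟨p - 1, by omega⟩
  -- `r` and `q` now stand for the original `r - 1` and `p - 1`.
  have hrq : r ≤ q + 1 := by simpa using (le_max_right _ _).trans hp
  -- Both real powers become natural powers of `√λ_{n+1}`; exponent `0` gives `1` even when `λ_{n+1}
  -- = 0`.
  rw [Real.rpow_div_two_eq_sqrt _ hl, Real.rpow_div_two_eq_sqrt _ hl, Real.rpow_natCast,
    Nat.cast_succ, add_sub_cancel_right, Real.rpow_natCast]
  refine ⟨fun u hu => ?_, fun u hu => ?_⟩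
  · refine RitzWidth.ritz_estimates (T := ContinuousLinearMap.adjoint K) (c := 1) (by simp)
      (by simp) (fun r f hf => by simpa using hderiv.1 r f hf) (Real.sqrt_nonneg _) X₀ Y₀
      hY₀ker hV hW hrq _ (fun f hf => ?_) hu
    rw [RitzWidth.ritzX, (hderiv.1 r f hf).weakDeriv_eq]
    rfl
  · refine RitzWidth.ritz_estimates (S := ContinuousLinearMap.adjoint K) (T := K) (c := -1) rfl
      (by simp) (fun r f hf => by simpa using hderiv.2 r f hf) (Real.sqrt_nonneg _) Y₀ X₀
      hX₀ker hW hV hrq _ (fun f hf => ?_) hu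
    -- The sign in `∂ K* g = -g` cancels the one in the definition of `R_{Y_p}`.
    rw [RitzWidth.ritzY, (hderiv.2 r f hf).weakDeriv_eq, map_neg, map_neg, neg_neg]
    rfl
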